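/- All vector spaces are complex and finite-dimensional. A quadratic $\mathbb{Z}_2$-graded vector space is a space $V=V_{\bar 0}\oplus V_{\bar 1}$ with a non-degenerate bilinear form $B$ that is even ($B(V_{\bar 0},V_{\bar 1})=0$) and supersymmetric ($B(X,Y)=(-1)^{xy}B(Y,X)$ for $X\in V_x$, $Y\in V_y$). A quadratic Lie superalgebra $(\mathfrak g,B)$ is such a space with a Lie superalgebra bracket satisfying $B([X,Y],Z)=B(X,[Y,Z])$. Write $I(X,Y,Z)=B([X,Y],Z)$, $\mathcal Z(\mathfrak g)$ for the center, and $\phi:\mathfrak g\to\mathfrak g^*$, $\phi(X)(Y)=B(X,Y)$. An endomorphism $C$ that is homogeneous of degree $c$ is skew-supersymmetric if $B(C(X),Y)=-(-1)^{cx}B(X,C(Y))$ for all $X\in\mathfrak g_x$, $Y\in\mathfrak g$. $\mathfrak g$ is reduced if $\mathfrak g\neq 0$ and $\mathcal Z(\mathfrak g)$ is totally isotropic. An element of $\mathfrak g_{\bar 0}^*\otimes\mathfrak g_{\bar 1}^*$ is regarded as a super-antisymmetric bilinear form, $\alpha\otimes q$ being $(X,Y)\mapsto\alpha(X)q(Y)-q(X)\alpha(Y)$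 (forms extended by zero to $\mathfrak g$). For $J\in\mathfrak g_{\bar 0}^*\otimes\mathfrak g_{\bar 1}^*$ and $p\in\mathfrak g_{\bar 1}^*$, the super-exterior product $J\wedge p$ is the super-antisymmetric trilinear form which vanishes on $\mathfrak g_{\bar 0}^3$, $\mathfrak g_{\bar 0}^2\times\mathfrak g_{\bar 1}$ and $\mathfrak g_{\bar 1}^3$ and satisfies $(J\wedge p)(X,Y,Z)=-J(X,Y)p(Z)-J(X,Z)p(Y)$ for $X\in\mathfrak g_{\bar 0}$, $Y,Z\in\mathfrak g_{\bar 1}$. Generalized double extension: let $(\mathfrak q,B_{\mathfrak q})$ be a quadratic $\mathbb{Z}_2$-graded vector space, $\overline C$ an odd skew-supersymmetric endomorphism of $\mathfrak q$ with $\overline C^2=0$, and $X_{\bar 0}'\in\mathfrak q_{\bar 0}$ with $B_{\mathfrak q}(X_{\bar 0}',X_{\bar 0}')=0$ and $\overline C(X_{\bar 0}')=0$. The generalized double extension of $\mathfrak q$ defined by $(\overline C,X_{\bar 0}')$ is the quadratic Lie superalgebra $\mathfrak q\overset{\perp}{\oplus}(\mathbb C X_{\bar 1}\oplus\mathbb C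 Y_{\bar 1})$ with $X_{\bar 1},Y_{\bar 1}$ odd, $B(X_{\bar 1},Y_{\bar 1})=1$, and, for $X,Y\in\mathfrak q$, $$[X_{\bar 1},\cdot]=0,\quad [Y_{\bar 1},Y_{\bar 1}]=X_{\bar 0}',\quad [Y_{\bar 1},X]=\overline C(X)-B(X,X_{\bar 0}')X_{\bar 1},\quad [X,Y]=-B(\overline C(X),Y)X_{\bar 1}.$$ **Statement.** Let $(\mathfrak g,B)$ be a quasi-singular quadratic Lie superalgebra, i.e. $I=J\wedge p$ with $p\in\mathfrak g_{\bar 1}^*$ nonzero and $J\in\mathfrak g_{\bar 0}^*\otimes\mathfrak g_{\bar 1}^*$ indecomposable (not of the form $\alpha\otimes q$). Let $C$ be the endomorphism of $\mathfrak g$ with $B(C(X),Y)=J(X,Y)$ for all $X,Y$, and let $X_{\bar 1}=\phi^{-1}(p)$. Then: 1. $C$ is odd and skew-supersymmetric, $C^2=0$ and $\operatorname{Im}(C)\subset\mathcal Z(\mathfrak g)$. 2. $[\mathfrak g,\mathfrak g]\subset\operatorname{Im}(C)+\mathbb C X_{\bar 1}\subset\mathcal Z(\mathfrak g)$, and $\mathfrak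 g$ is 2-step nilpotent ($[\mathfrak g,\mathfrak g]\ne0$ and $[\mathfrak g,[\mathfrak g,\mathfrak g]]=0$). If $\mathfrak g$ is reduced, then $[\mathfrak g,\mathfrak g]=\operatorname{Im}(C)+\mathbb C X_{\bar 1}=\mathcal Z(\mathfrak g)$. 3. $X_{\bar 1}$ is odd and there is $Y_{\bar 1}\in\mathfrak g_{\bar 1}$ with $B(X_{\bar 1},Y_{\bar 1})=1$. For every such $Y_{\bar 1}$, with $X_{\bar 0}=C(Y_{\bar 1})$ and $\mathfrak q=(\mathbb C X_{\bar 1}\oplus\mathbb C Y_{\bar 1})^{\perp}$, one has, for all $X,Y\in\mathfrak q\oplus\mathbb C X_{\bar 1}$, $$[Y_{\bar 1},Y_{\bar 1}]=2X_{\bar 0},\quad [Y_{\bar 1},X]=C(X)-B(X,X_{\bar 0})X_{\bar 1},\quad [X,Y]=-B(C(X),Y)X_{\bar 1}.$$ 4. For every such $Y_{\bar 1}$, $\mathfrak q$ with the induced grading and form is a quadratic $\mathbb{Z}_2$-graded vector space, and there is an odd skew-supersymmetric $\overline C:\mathfrak q\to\mathfrak q$ with $\overline C^2=0$ and $C(X)=\overline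 C(X)-B(X,X_{\bar 0})X_{\bar 1}$ for $X\in\mathfrak q$. The vector $X_{\bar 0}'=2X_{\bar 0}\in\mathfrak q_{\bar 0}$ is isotropic with $\overline C(X_{\bar 0}')=0$, and for all $X,Y\in\mathfrak q$ $$[Y_{\bar 1},Y_{\bar 1}]=X_{\bar 0}',\quad [Y_{\bar 1},X]=\overline C(X)-B(X,X_{\bar 0}')X_{\bar 1},\quad [X,Y]=-B(\overline C(X),Y)X_{\bar 1}.$$ The decomposition $\mathfrak g=\mathfrak q\oplus\mathbb C X_{\bar 1}\oplus\mathbb C Y_{\bar 1}$ identifies $\mathfrak g$, isometrically and as a Lie superalgebra, with the generalized double extension of $\mathfrak q$ defined by $(\overline C,X_{\bar 0}')$. In particular, $\mathfrak g$ is a generalized double extension of a quadratic $\mathbb{Z}_2$-graded vector space. -/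

import Mathlib

open scoped TensorProduct

noncomputable section

namespace QuasiSingular

/-- The sign `(-1)^{ij}` attached to two parities `i, j ∈ ℤ/2ℤ`. -/
def superSign (i j : ZMod 2) : ℂ := (-1) ^ (i.val * j.val)

/-- A quadratic `ℤ/2ℤ`-graded vector space: `V = V₀ ⊕ V₁` with a non-degenerate even
supersymmetric bilinear form. -/
structure QuadraticSuperspace (V : Type*) [AddCommGroup V] [Module ℂ V] where
  /-- the homogeneous components `V₀` and `V₁` -/
  part : ZMod 2 → Submodule ℂ V
  isCompl : IsCompl (part 0) (part 1)
  form : LinearMap.BilinForm ℂ V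
  form_even : ∀ i j, i ≠ j → ∀ x ∈ part i, ∀ y ∈ part j, form x y = 0
  form_supersymm : ∀ i j, ∀ x ∈ part i, ∀ y ∈ part j, form x y = superSign i j * form y x
  nondegenerate : form.Nondegenerate

namespace QuadraticSuperspace

variable {V : Type*} [AddCommGroup V] [Module ℂ V] (Q : QuadraticSuperspace V)

/-- The projection of `V` on its homogeneous component of parity `i`, as an endomorphism. -/
def component (i : ZMod 2) : V →ₗ[ℂ] V :=
  if i = 0 then (Q.part 0).projection (Q.part 1) Q.isCompl
  else (Q.part 1).projection (Q.part 0) Q.isCompl.symm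

/-- An endomorphism which is homogeneous of degree `c`. -/
def IsHomogeneous (c : ZMod 2) (C : V →ₗ[ℂ] V) : Prop :=
  ∀ i, ∀ x ∈ Q.part i, C x ∈ Q.part (i + c)

/-- Skew-supersymmetry of an endomorphism of degree `c`:
`B(C x, y) = -(-1)^{c i} B(x, C y)` for `x` of parity `i` and all `y`. -/
def IsSkewSupersymmetric (c : ZMod 2) (C : V →ₗ[ℂ] V) : Prop :=
  ∀ i, ∀ x ∈ Q.part i, ∀ y, Q.form (C x) y = -superSign c i * Q.form x (C y)

/-- An even linear form `α ∈ V₀*`, extended by zero on `V₁`. -/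
def extendEven : Module.Dual ℂ (Q.part 0) →ₗ[ℂ] Module.Dual ℂ V :=
  LinearMap.lcomp ℂ ℂ ((Q.part 0).projectionOnto (Q.part 1) Q.isCompl)

/-- An odd linear form `p ∈ V₁*`, extended by zero on `V₀`. -/
def extendOdd : Module.Dual ℂ (Q.part 1) →ₗ[ℂ] Module.Dual ℂ V :=
  LinearMap.lcomp ℂ ℂ ((Q.part 1).projectionOnto (Q.part 0) Q.isCompl.symm)

/-- An element of `Alt¹(V₀) ⊗ Sym¹(V₁) = V₀* ⊗ V₁*` regarded as a super-antisymmetric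
bilinear form on `V`: the tensor `α ⊗ q` is the form
`(X, Y) ↦ α(X) q(Y) - q(X) α(Y)`. -/
def tensorForm :
    Module.Dual ℂ (Q.part 0) ⊗[ℂ] Module.Dual ℂ (Q.part 1) →ₗ[ℂ] LinearMap.BilinForm ℂ V :=
  TensorProduct.lift (LinearMap.mk₂ ℂ
    (fun α q =>
      (LinearMap.mul ℂ ℂ).compl₁₂ (Q.extendEven α) (Q.extendOdd q) -
        (LinearMap.mul ℂ ℂ).compl₁₂ (Q.extendOdd q) (Q.extendEven α))
    (by intros; ext; simp; ring) (by intros; ext; simp; ring)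
    (by intros; ext; simp; ring) (by intros; ext; simp; ring))

/-- The super-exterior product `J ∧ p` of a bilinear form `J` and a linear form `p` of parity `b`,
as a trilinear form. On homogeneous `X, Y, Z` it is the sum over the three `(2,1)`-shuffles of
`(X, Y, Z)`, each with the sign of the shuffle, the Koszul sign for interchanging the arguments,
and the Koszul sign for moving `p` past the two arguments of `J`; it is extended to all of `V` by
linearity. -/
def superWedge (J : LinearMap.BilinForm ℂ V) (b : ZMod 2) (p : Module.Dual ℂ V) (X Y Z : V) : ℂ :=
  ∑ i : ZMod 2, ∑ j : ZMod 2, ∑ k : ZMod 2,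
    (superSign b (i + j) * J (Q.component i X) (Q.component j Y) * p (Q.component k Z)
      - superSign j k * superSign b (i + k) *
          J (Q.component i X) (Q.component k Z) * p (Q.component j Y)
      + superSign i (j + k) * superSign b (j + k) *
          J (Q.component j Y) (Q.component k Z) * p (Q.component i X))

/-- The isomorphism `φ : V → V*`, `φ(X)(Y) = B(X, Y)`. -/
def phi [FiniteDimensional ℂ V] : V ≃ₗ[ℂ] Module.Dual ℂ V :=
  Q.form.toDual Q.nondegenerate

end QuadraticSuperspace

/-- A quadratic Lie superalgebra: a Lie superalgebra structure on a quadratic `ℤ/2ℤ`-graded vector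
space whose bilinear form is invariant. -/
structure QuadraticLieSuperalgebra (V : Type*) [AddCommGroup V] [Module ℂ V]
    extends QuadraticSuperspace V where
  bracket : V →ₗ[ℂ] V →ₗ[ℂ] V
  bracket_mem : ∀ i j, ∀ x ∈ part i, ∀ y ∈ part j, bracket x y ∈ part (i + j)
  bracket_skew : ∀ i j, ∀ x ∈ part i, ∀ y ∈ part j,
    bracket x y = -(superSign i j • bracket y x)
  jacobi : ∀ i j k, ∀ x ∈ part i, ∀ y ∈ part j, ∀ z ∈ part k,
    bracket x (bracket y z) =
      bracket (bracket x y) z + superSign i j • bracket y (bracket x z)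
  invariant : ∀ x y z, form (bracket x y) z = form x (bracket y z)

namespace QuadraticLieSuperalgebra

variable {V : Type*} [AddCommGroup V] [Module ℂ V] (L : QuadraticLieSuperalgebra V)

/-- The associated invariant `I(X, Y, Z) = B([X, Y], Z)`. -/
def associatedInvariant (X Y Z : V) : ℂ := L.form (L.bracket X Y) Z

/-- The center. -/
def center : Submodule ℂ V := LinearMap.ker L.bracket

/-- The derived ideal `[𝔤, 𝔤]`. -/
def derived : Submodule ℂ V := Submodule.span ℂ {z | ∃ x y, z = L.bracket x y}

/-- `𝔤` is nilpotent of class exactly two: `[𝔤, 𝔤] ≠ 0` and `[𝔤, [𝔤, 𝔤]] = 0`. -/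
def IsTwoStepNilpotent : Prop :=
  L.derived ≠ ⊥ ∧ ∀ x, ∀ y ∈ L.derived, L.bracket x y = 0

/-- `𝔤` is reduced: it is nonzero and its center is totally isotropic. -/
def IsReduced : Prop :=
  Nontrivial V ∧ ∀ x ∈ L.center, ∀ y ∈ L.center, L.form x y = 0

/-- The associated invariant is `I = J ∧ p` with `p ∈ 𝔤₁*` nonzero and
`J ∈ Alt¹(𝔤₀) ⊗ Sym¹(𝔤₁)` indecomposable, i.e. not of the form `α ⊗ q`. -/
structure IsQuasiSingularWith
    (J : Module.Dual ℂ (L.part 0) ⊗[ℂ] Module.Dual ℂ (L.part 1))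
    (p : Module.Dual ℂ (L.part 1)) : Prop where
  ne_zero : p ≠ 0
  indecomposable : ∀ (α : Module.Dual ℂ (L.part 0)) (q : Module.Dual ℂ (L.part 1)), J ≠ α ⊗ₜ[ℂ] q
  invariant_eq : ∀ X Y Z, L.associatedInvariant X Y Z =
    L.superWedge (L.tensorForm J) 1 (L.extendOdd p) X Y Z

/-- `e` is an isometric isomorphism of quadratic Lie superalgebras. -/
structure IsIsometricIso {W : Type*} [AddCommGroup W] [Module ℂ W]
    (M : QuadraticLieSuperalgebra W) (e : V ≃ₗ[ℂ] W) : Prop where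
  map_part : ∀ i, ∀ x ∈ L.part i, e x ∈ M.part i
  map_bracket : ∀ x y, e (L.bracket x y) = M.bracket (e x) (e y)
  map_form : ∀ x y, M.form (e x) (e y) = L.form x y

/-- The endomorphism `C` of `𝔤` with `B(C X, Y) = J(X, Y)` for all `X, Y`. -/
def mapOf [FiniteDimensional ℂ V]
    (J : Module.Dual ℂ (L.part 0) ⊗[ℂ] Module.Dual ℂ (L.part 1)) : V →ₗ[ℂ] V :=
  L.phi.symm.toLinearMap ∘ₗ L.tensorForm J

/-- The vector `X₁ = φ⁻¹(p)`. -/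
def vectorOf [FiniteDimensional ℂ V] (p : Module.Dual ℂ (L.part 1)) : V :=
  L.phi.symm (L.extendOdd p)

end QuadraticLieSuperalgebra

/-- The data for a generalized double extension of a quadratic `ℤ/2ℤ`-graded vector space `𝔮`
(regarded as an Abelian Lie superalgebra) by a one-dimensional odd Lie superalgebra: an odd
skew-supersymmetric endomorphism of `𝔮` with square zero, and an isotropic even vector in its
kernel. -/
structure ExtensionDatum (V : Type*) [AddCommGroup V] [Module ℂ V]
    extends QuadraticSuperspace V where
  map : V →ₗ[ℂ] V
  map_odd : toQuadraticSuperspace.IsHomogeneous 1 map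
  map_skew : toQuadraticSuperspace.IsSkewSupersymmetric 1 map
  map_sq : ∀ x, map (map x) = 0
  vec : V
  vec_even : vec ∈ part 0
  vec_isotropic : form vec vec = 0
  map_vec : map vec = 0

namespace ExtensionDatum

variable {V : Type*} [AddCommGroup V] [Module ℂ V] (D : ExtensionDatum V)

/-- The parity involution: `x` on even vectors and `-x` on odd ones. -/
def theta : V →ₗ[ℂ] V := D.component 0 - D.component 1

/-- The homogeneous components of `𝔮 ⊕ ℂ X₁ ⊕ ℂ Y₁`, where `X₁` and `Y₁` are odd. -/
def extPart (i : ZMod 2) : Submodule ℂ (V × ℂ × ℂ) :=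
  (D.part i).prod (if i = 0 then ⊥ else ⊤)

/-- The bilinear form `B_𝔮 + B_𝔱` on `𝔮 ⊕ ℂ X₁ ⊕ ℂ Y₁`, with `B(X₁, Y₁) = 1 = -B(Y₁, X₁)`. The
triple `(x, a, b)` stands for `x + a X₁ + b Y₁`. -/
def extForm : LinearMap.BilinForm ℂ (V × ℂ × ℂ) :=
  LinearMap.mk₂ ℂ (fun u v => D.form u.1 v.1 + (u.2.1 * v.2.2 - u.2.2 * v.2.1))
    (by intros; simp; ring) (by intros; simp; ring)
    (by intros; simp; ring) (by intros; simp; ring)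

/-- The bracket on `𝔮 ⊕ ℂ X₁ ⊕ ℂ Y₁`: the bilinear super-antisymmetric map with
`[Y₁, Y₁] = X₀`, `[Y₁, x] = C x - B(x, X₀) X₁`, `[x, y] = -B(C x, y) X₁` and `[X₁, ·] = 0`
for `x, y ∈ 𝔮`. -/
def extBracket : (V × ℂ × ℂ) →ₗ[ℂ] (V × ℂ × ℂ) →ₗ[ℂ] (V × ℂ × ℂ) :=
  LinearMap.mk₂ ℂ
    (fun u v =>
      (u.2.2 • D.map v.1 - v.2.2 • D.map (D.theta u.1) + (u.2.2 * v.2.2) • D.vec,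
        -D.form (D.map u.1) v.1 - u.2.2 * D.form v.1 D.vec + v.2.2 * D.form u.1 D.vec, 0))
    (by
      intros; ext
      · simp; module
      · simp; ring
      · simp)
    (by
      intros; ext
      · simp; module
      · simp; ring
      · simp)
    (by
      intros; ext
      · simp; module
      · simp; ring
      · simp)
    (by
      intros; ext
      · simp; module
      · simp; ring
      · simp)

theorem exists_add (x : V) : ∃ y ∈ D.part 0, ∃ z ∈ D.part 1, x = y + z := by
  have h : x ∈ D.part 0 ⊔ D.part 1 := by rw [D.isCompl.sup_eq_top]; trivial
  obtain ⟨y, hy, z, hz, rfl⟩ := Submodule.mem_sup.1 h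
  exact ⟨y, hy, z, hz, rfl⟩

theorem theta_even {x : V} (hx : x ∈ D.part 0) : D.theta x = x := by
  simp [theta, QuadraticSuperspace.component, Submodule.projection_apply_of_mem_left _ hx,
    (Submodule.projection_apply_eq_zero_iff D.isCompl.symm).2 hx]

theorem theta_odd {x : V} (hx : x ∈ D.part 1) : D.theta x = -x := by
  simp [theta, QuadraticSuperspace.component, Submodule.projection_apply_of_mem_left _ hx,
    (Submodule.projection_apply_eq_zero_iff D.isCompl).2 hx]

theorem map_even {x : V} (hx : x ∈ D.part 0) : D.map x ∈ D.part 1 := D.map_odd 0 x hx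

theorem map_of_odd {x : V} (hx : x ∈ D.part 1) : D.map x ∈ D.part 0 := D.map_odd 1 x hx

theorem form_map_left (x y : V) : D.form (D.map x) y = -D.form (D.theta x) (D.map y) := by
  obtain ⟨a, ha, b, hb, rfl⟩ := D.exists_add x
  have h0 := D.map_skew 0 a ha y
  have h1 := D.map_skew 1 b hb y
  simp only [superSign, ZMod.val_zero, ZMod.val_one, mul_zero, mul_one, pow_zero, pow_one] at h0 h1
  simp only [map_add, LinearMap.add_apply, h0, h1, D.theta_even ha, D.theta_odd hb, map_neg,
    LinearMap.neg_apply]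
  ring

theorem form_theta_left (x y : V) : D.form (D.theta x) y = D.form x (D.theta y) := by
  obtain ⟨a, ha, b, hb, rfl⟩ := D.exists_add x
  obtain ⟨c, hc, d, hd, rfl⟩ := D.exists_add y
  have h0 := D.form_even 0 1 (by decide) a ha d hd
  have h1 := D.form_even 1 0 (by decide) b hb c hc
  simp [D.theta_even ha, D.theta_odd hb, D.theta_even hc, D.theta_odd hd, h0, h1]

theorem theta_map (x : V) : D.theta (D.map x) = -D.map (D.theta x) := by
  obtain ⟨a, ha, b, hb, rfl⟩ := D.exists_add x
  simp only [map_add, D.theta_even ha, D.theta_odd hb, D.theta_odd (D.map_even ha),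
    D.theta_even (D.map_of_odd hb), map_neg]
  abel

theorem theta_theta (x : V) : D.theta (D.theta x) = x := by
  obtain ⟨a, ha, b, hb, rfl⟩ := D.exists_add x
  simp [D.theta_even ha, D.theta_odd hb]

theorem form_vec (x : V) : D.form D.vec x = D.form x D.vec := by
  obtain ⟨a, ha, b, hb, rfl⟩ := D.exists_add x
  have h0 := D.form_supersymm 0 0 _ D.vec_even a ha
  have h1 := D.form_even 0 1 (by decide) _ D.vec_even b hb
  have h2 := D.form_even 1 0 (by decide) b hb _ D.vec_even
  simp only [superSign, ZMod.val_zero, mul_zero, pow_zero, one_mul] at h0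
  simp [h0, h1, h2]

theorem form_theta_vec (x : V) : D.form (D.theta x) D.vec = D.form x D.vec := by
  rw [form_theta_left, D.theta_even D.vec_even]

theorem extBracket_extBracket (u v w : V × ℂ × ℂ) :
    D.extBracket u (D.extBracket v w) = 0 := by
  simp [extBracket, D.map_sq, D.map_vec, form_map_left, D.vec_isotropic]

theorem extBracket_extBracket_left (u v w : V × ℂ × ℂ) :
    D.extBracket (D.extBracket u v) w = 0 := by
  have h : D.form D.vec (D.map w.1) = 0 := by
    have := D.form_map_left D.vec w.1
    rw [D.map_vec, D.theta_even D.vec_even] at this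
    simpa using this
  simp [extBracket, D.map_sq, D.map_vec, form_map_left, D.vec_isotropic,
    D.theta_map, D.theta_even D.vec_even, D.theta_theta, h]

theorem parity_cases (i : ZMod 2) : i = 0 ∨ i = 1 := by revert i; decide

theorem mem_extPart_zero {u : V × ℂ × ℂ} : u ∈ D.extPart 0 ↔ u.1 ∈ D.part 0 ∧ u.2 = 0 := by
  simp [extPart, Submodule.mem_prod]

theorem mem_extPart_one {u : V × ℂ × ℂ} : u ∈ D.extPart 1 ↔ u.1 ∈ D.part 1 := by
  simp [extPart, Submodule.mem_prod]

/-- The generalized double extension of `𝔮` given by the datum `D`, as a quadratic Lie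
superalgebra on `𝔮 ⊕ ℂ X₁ ⊕ ℂ Y₁`. -/
def extension : QuadraticLieSuperalgebra (V × ℂ × ℂ) where
  part := D.extPart
  isCompl := by
    constructor
    · rw [Submodule.disjoint_def]
      rintro ⟨x, y⟩ ⟨h0, h0'⟩ ⟨h1, -⟩
      have : x = 0 := Submodule.disjoint_def.1 D.isCompl.disjoint x h0 h1
      simp_all
    · rw [codisjoint_iff, eq_top_iff]
      rintro ⟨x, y⟩ -
      obtain ⟨a, ha, b, hb, rfl⟩ := D.exists_add x
      refine Submodule.mem_sup.2 ⟨(a, 0), ⟨ha, by simp⟩, (b, y), ⟨hb, by simp⟩, by simp⟩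
  form := D.extForm
  form_even := by
    intro i j hij x hx y hy
    have h := D.form_even i j hij x.1 hx.1 y.1 hy.1
    have h' : x.2 = 0 ∨ y.2 = 0 := by
      rcases parity_cases i with rfl | rfl
      · exact Or.inl (D.mem_extPart_zero.1 hx).2
      · rcases parity_cases j with rfl | rfl
        · exact Or.inr (D.mem_extPart_zero.1 hy).2
        · exact absurd rfl hij
    rcases h' with h' | h' <;> simp [extForm, h, h']
  form_supersymm := by
    intro i j x hx y hy
    have h := D.form_supersymm i j x.1 hx.1 y.1 hy.1
    simp only [extForm, LinearMap.mk₂_apply, h]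
    rcases parity_cases i with rfl | rfl
    · simp [(D.mem_extPart_zero.1 hx).2]
    · rcases parity_cases j with rfl | rfl
      · simp [(D.mem_extPart_zero.1 hy).2]
      · simp only [superSign, ZMod.val_one]
        ring
  nondegenerate := by
    constructor
    · rintro ⟨x, a, b⟩ h
      have h0 : x = 0 := D.nondegenerate.1 x fun y => by simpa [extForm] using h (y, 0, 0)
      have h1 : a = 0 := by simpa [extForm] using h (0, 0, 1)
      have h2 : b = 0 := by simpa [extForm] using h (0, 1, 0)
      simp [h0, h1, h2]
    · rintro ⟨x, a, b⟩ h
      have h0 : x = 0 := D.nondegenerate.2 x fun y => by simpa [extForm] using h (y, 0, 0)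
      have h1 : a = 0 := by simpa [extForm] using h (0, 0, 1)
      have h2 : b = 0 := by simpa [extForm] using h (0, 1, 0)
      simp [h0, h1, h2]
  bracket := D.extBracket
  bracket_mem := by
    rintro i j ⟨x, a, b⟩ hx ⟨y, c, d⟩ hy
    rcases parity_cases i with rfl | rfl <;> rcases parity_cases j with rfl | rfl
    · rw [mem_extPart_zero] at hx hy
      obtain ⟨hx, hx'⟩ := hx
      obtain ⟨hy, hy'⟩ := hy
      simp only [Prod.mk_eq_zero] at hx' hy'
      obtain ⟨rfl, rfl⟩ := hx'
      obtain ⟨rfl, rfl⟩ := hy'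
      have h := D.form_even 1 0 (by decide) _ (D.map_even hx) y hy
      simp [extBracket, h, mem_extPart_zero]
    · rw [mem_extPart_zero] at hx
      rw [mem_extPart_one] at hy
      obtain ⟨hx, hx'⟩ := hx
      simp only [Prod.mk_eq_zero] at hx'
      obtain ⟨rfl, rfl⟩ := hx'
      rw [zero_add, mem_extPart_one]
      simpa [extBracket, D.theta_even hx] using (D.part 1).smul_mem d (D.map_even hx)
    · rw [mem_extPart_zero] at hy
      rw [mem_extPart_one] at hx
      obtain ⟨hy, hy'⟩ := hy
      simp only [Prod.mk_eq_zero] at hy'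
      obtain ⟨rfl, rfl⟩ := hy'
      rw [add_zero, mem_extPart_one]
      simpa [extBracket] using (D.part 1).smul_mem b (D.map_even hy)
    · rw [mem_extPart_one] at hx hy
      have h := D.form_even 0 1 (by decide) _ (D.map_of_odd hx) y hy
      have h1 := D.form_even 1 0 (by decide) x hx _ D.vec_even
      have h2 := D.form_even 1 0 (by decide) y hy _ D.vec_even
      rw [show (1 : ZMod 2) + 1 = 0 from rfl, mem_extPart_zero]
      refine ⟨?_, by simp_all [extBracket]⟩
      simp only [extBracket, LinearMap.mk₂_apply, D.theta_odd hx]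
      refine add_mem (sub_mem ?_ ?_) ?_
      · exact (D.part 0).smul_mem _ (D.map_of_odd hy)
      · exact (D.part 0).smul_mem _ (D.map_of_odd (neg_mem hx))
      · exact (D.part 0).smul_mem _ D.vec_even
  bracket_skew := by
    rintro i j ⟨x, a, b⟩ hx ⟨y, c, d⟩ hy
    have hs := D.form_map_left x y
    rcases parity_cases i with rfl | rfl <;> rcases parity_cases j with rfl | rfl
    · rw [mem_extPart_zero] at hx hy
      obtain ⟨hx, hx'⟩ := hx
      obtain ⟨hy, hy'⟩ := hy
      simp only [Prod.mk_eq_zero] at hx' hy'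
      obtain ⟨rfl, rfl⟩ := hx'
      obtain ⟨rfl, rfl⟩ := hy'
      have h := D.form_even 1 0 (by decide) _ (D.map_even hx) y hy
      have h' := D.form_even 1 0 (by decide) _ (D.map_even hy) x hx
      simp [extBracket, h, h']
    · rw [mem_extPart_zero] at hx
      rw [mem_extPart_one] at hy
      obtain ⟨hx, hx'⟩ := hx
      simp only [Prod.mk_eq_zero] at hx'
      obtain ⟨rfl, rfl⟩ := hx'
      have h := D.form_supersymm 0 0 x hx _ (D.map_of_odd hy)
      simp only [superSign, ZMod.val_zero, mul_zero, pow_zero, one_mul] at h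
      rw [D.theta_even hx, h] at hs
      have h2 := D.form_even 1 0 (by decide) y hy _ D.vec_even
      simp [extBracket, D.theta_even hx, hs, superSign, h2]
      ring
    · rw [mem_extPart_zero] at hy
      rw [mem_extPart_one] at hx
      obtain ⟨hy, hy'⟩ := hy
      simp only [Prod.mk_eq_zero] at hy'
      obtain ⟨rfl, rfl⟩ := hy'
      have h := D.form_supersymm 1 1 x hx _ (D.map_even hy)
      simp only [superSign, ZMod.val_one, mul_one, pow_one] at h
      rw [D.theta_odd hx, map_neg, LinearMap.neg_apply, neg_neg, h] at hs
      simp [extBracket, D.theta_even hy, hs, superSign]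
      ring
    · rw [mem_extPart_one] at hx hy
      have h := D.form_even 0 1 (by decide) _ (D.map_of_odd hx) y hy
      have h' := D.form_even 0 1 (by decide) _ (D.map_of_odd hy) x hx
      have h1 := D.form_even 1 0 (by decide) x hx _ D.vec_even
      have h2 := D.form_even 1 0 (by decide) y hy _ D.vec_even
      simp [extBracket, D.theta_odd hx, D.theta_odd hy, superSign, ZMod.val_one, h, h', h1, h2]
      module
  jacobi := by
    intros
    simp [extBracket_extBracket, extBracket_extBracket_left]
  invariant := by
    rintro ⟨x, a, b⟩ ⟨y, c, d⟩ ⟨z, e, f⟩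
    have h1 : D.form (D.map x) y = D.form x (D.map (D.theta y)) := by
      rw [form_map_left, form_theta_left, theta_map, map_neg, neg_neg]
    have h2 : D.form (D.map (D.theta x)) z = -D.form x (D.map z) := by
      rw [form_map_left, theta_theta]
    simp only [extForm, extBracket, LinearMap.mk₂_apply, map_add, map_sub, map_smul,
      LinearMap.add_apply, LinearMap.sub_apply, LinearMap.smul_apply, smul_eq_mul, h1, h2,
      form_vec]
    ring

end ExtensionDatum

/-- `𝔤` is isometrically isomorphic to a generalized double extension of a quadratic
`ℤ/2ℤ`-graded vector space. -/
def QuadraticLieSuperalgebra.IsGeneralizedDoubleExtension.{u} {V : Type u} [AddCommGroup V]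
    [Module ℂ V] (L : QuadraticLieSuperalgebra V) : Prop :=
  ∃ (W : Type u) (_ : AddCommGroup W) (_ : Module ℂ W) (_ : FiniteDimensional ℂ W)
    (D : ExtensionDatum W) (e : V ≃ₗ[ℂ] W × ℂ × ℂ), L.IsIsometricIso D.extension e

end QuasiSingular

end

namespace QuasiSingular

/-! Non-degeneracy of `B` turns `I = J ∧ p` into explicit brackets in `C` and `X₁`: zero on two even
vectors, `-B(C x, y) X₁ - B(X₁, y) C x` on even-odd pairs, `B(X₁, y) C x + B(X₁, x) C y` on odd
pairs (`isWedgeBracket`). Everything then rests on `C X₁ = 0` and `C² = 0`, which are extracted from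
the Jacobi identity with an odd `y` such that `B(X₁, y) = 1`.

Suppose `C X₁ ≠ 0`. The identities for (even, even, `y`) and (even, `y`, `y`) force `C` to vanish on
the even vectors orthogonal to `C X₁`, so `C` has rank at most one on the even part and `J` would be
decomposable (`map_vec`). The identity for (even, `y`, `y`) then gives `C² = 0` on even vectors. On
odd vectors the identity for (`y`, `y`, `z`), paired with `y`, gives scalar equations whose only
solution is zero (`map_map_odd`).

A single formula for the bracket (`bracket_eq`) now shows that `Im C` and `X₁` are central and
contain all brackets. In the reduced case, duality between center and derived ideal closes the chain
of inclusions. Splitting off the odd hyperbolic plane of `X₁` and `Y₁`, and correcting `C` by a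
multiple of `X₁` so that it preserves the complement, yields the extension datum. -/

@[simp] theorem superSign_zero_left (i : ZMod 2) : superSign 0 i = 1 := by simp [superSign]

@[simp] theorem superSign_zero_right (i : ZMod 2) : superSign i 0 = 1 := by simp [superSign]

@[simp] theorem superSign_one_one : superSign 1 1 = -1 := by simp [superSign, ZMod.val_one]

theorem sum_zmod_two {M : Type*} [AddCommMonoid M] (f : ZMod 2 → M) : ∑ i, f i = f 0 + f 1 :=
  Fin.sum_univ_two f

/-! ### Parity, the form and tensors on a quadratic graded space -/

namespace QuadraticSuperspace

variable {V : Type*} [AddCommGroup V] [Module ℂ V] (Q : QuadraticSuperspace V)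

theorem exists_add (x : V) : ∃ y ∈ Q.part 0, ∃ z ∈ Q.part 1, x = y + z := by
  have h : x ∈ Q.part 0 ⊔ Q.part 1 := by rw [Q.isCompl.sup_eq_top]; trivial
  obtain ⟨y, hy, z, hz, rfl⟩ := Submodule.mem_sup.1 h
  exact ⟨y, hy, z, hz, rfl⟩

theorem component_zero_even {x : V} (hx : x ∈ Q.part 0) : Q.component 0 x = x := by
  simp [component, Submodule.projection_apply_of_mem_left _ hx]

theorem component_one_even {x : V} (hx : x ∈ Q.part 0) : Q.component 1 x = 0 := by
  simp [component, (Submodule.projection_apply_eq_zero_iff Q.isCompl.symm).2 hx]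

theorem component_zero_odd {x : V} (hx : x ∈ Q.part 1) : Q.component 0 x = 0 := by
  simp [component, (Submodule.projection_apply_eq_zero_iff Q.isCompl).2 hx]

theorem component_one_odd {x : V} (hx : x ∈ Q.part 1) : Q.component 1 x = x := by
  simp [component, Submodule.projection_apply_of_mem_left _ hx]

/-- The parity involution: `x` on even vectors and `-x` on odd ones. -/
noncomputable def parity : V →ₗ[ℂ] V := Q.component 0 - Q.component 1

theorem parity_even {x : V} (hx : x ∈ Q.part 0) : Q.parity x = x := by
  simp [parity, Q.component_zero_even hx, Q.component_one_even hx]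

theorem parity_odd {x : V} (hx : x ∈ Q.part 1) : Q.parity x = -x := by
  simp [parity, Q.component_zero_odd hx, Q.component_one_odd hx]

theorem form_even_odd {x y : V} (hx : x ∈ Q.part 0) (hy : y ∈ Q.part 1) : Q.form x y = 0 :=
  Q.form_even 0 1 (by decide) x hx y hy

theorem form_odd_even {x y : V} (hx : x ∈ Q.part 1) (hy : y ∈ Q.part 0) : Q.form x y = 0 :=
  Q.form_even 1 0 (by decide) x hx y hy

theorem form_comm_of_even {x : V} (hx : x ∈ Q.part 0) (y : V) : Q.form y x = Q.form x y := by
  obtain ⟨a, ha, b, hb, rfl⟩ := Q.exists_add y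
  have h := Q.form_supersymm 0 0 a ha x hx
  simp only [superSign_zero_left, one_mul] at h
  simp [h, Q.form_even_odd hx hb, Q.form_odd_even hb hx]

theorem form_comm_of_odd {x : V} (hx : x ∈ Q.part 1) (y : V) : Q.form y x = -Q.form x y := by
  obtain ⟨a, ha, b, hb, rfl⟩ := Q.exists_add y
  have h := Q.form_supersymm 1 1 b hb x hx
  simp only [superSign_one_one, neg_mul, one_mul] at h
  simp [h, Q.form_even_odd ha hx, Q.form_odd_even hx ha]

theorem form_self_of_odd {x : V} (hx : x ∈ Q.part 1) : Q.form x x = 0 := by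
  have h := Q.form_comm_of_odd hx x
  linear_combination h / 2

theorem ext_form {x y : V} (h : ∀ z, Q.form x z = Q.form y z) : x = y :=
  sub_eq_zero.1 (Q.nondegenerate.1 _ fun z => by simp [h z])

theorem ext_form_homogeneous {x y : V} (h₀ : ∀ z ∈ Q.part 0, Q.form x z = Q.form y z)
    (h₁ : ∀ z ∈ Q.part 1, Q.form x z = Q.form y z) : x = y := by
  refine Q.ext_form fun z => ?_
  obtain ⟨a, ha, b, hb, rfl⟩ := Q.exists_add z
  rw [map_add, map_add, h₀ a ha, h₁ b hb]

/-- The form is even and non-degenerate, so an odd component pairing to zero with all odd vectors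
vanishes. -/
theorem mem_part_zero_of_form {x : V} (h : ∀ z ∈ Q.part 1, Q.form x z = 0) : x ∈ Q.part 0 := by
  obtain ⟨a, ha, b, hb, rfl⟩ := Q.exists_add x
  have hb0 : b = 0 := by
    refine Q.ext_form_homogeneous (fun z hz => ?_) fun z hz => ?_
    · simp [Q.form_odd_even hb hz]
    · simpa [Q.form_even_odd ha hz] using h z hz
  simpa [hb0] using ha

theorem mem_part_one_of_form {x : V} (h : ∀ z ∈ Q.part 0, Q.form x z = 0) : x ∈ Q.part 1 := by
  obtain ⟨a, ha, b, hb, rfl⟩ := Q.exists_add x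
  have ha0 : a = 0 := by
    refine Q.ext_form_homogeneous (fun z hz => ?_) fun z hz => ?_
    · simpa [Q.form_odd_even hb hz] using h z hz
    · simp [Q.form_even_odd ha hz]
  simpa [ha0] using hb

theorem form_phi_symm [FiniteDimensional ℂ V] (f : Module.Dual ℂ V) (y : V) :
    Q.form (Q.phi.symm f) y = f y :=
  congrArg (fun g : Module.Dual ℂ V => g y) (Q.phi.apply_symm_apply f)

theorem extendEven_apply (α : Module.Dual ℂ (Q.part 0)) (x : Q.part 0) :
    Q.extendEven α x = α x := by
  simp [extendEven]

theorem extendEven_odd (α : Module.Dual ℂ (Q.part 0)) {x : V} (hx : x ∈ Q.part 1) :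
    Q.extendEven α x = 0 := by
  simp [extendEven, (Submodule.projectionOnto_apply_eq_zero_iff Q.isCompl).2 hx]

theorem extendOdd_apply (q : Module.Dual ℂ (Q.part 1)) (x : Q.part 1) :
    Q.extendOdd q x = q x := by
  simp [extendOdd]

theorem extendOdd_even (q : Module.Dual ℂ (Q.part 1)) {x : V} (hx : x ∈ Q.part 0) :
    Q.extendOdd q x = 0 := by
  simp [extendOdd, (Submodule.projectionOnto_apply_eq_zero_iff Q.isCompl.symm).2 hx]

theorem tensorForm_tmul (α : Module.Dual ℂ (Q.part 0)) (q : Module.Dual ℂ (Q.part 1)) (x y : V) :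
    Q.tensorForm (α ⊗ₜ q) x y =
      Q.extendEven α x * Q.extendOdd q y - Q.extendOdd q x * Q.extendEven α y := by
  simp [tensorForm]

variable (J : Module.Dual ℂ (Q.part 0) ⊗[ℂ] Module.Dual ℂ (Q.part 1))

theorem tensorForm_antisymm (x y : V) : Q.tensorForm J x y = -Q.tensorForm J y x := by
  induction J with
  | zero => simp
  | tmul α q => simp only [tensorForm_tmul]; ring
  | add a b ha hb => simp only [map_add, LinearMap.add_apply, ha, hb]; ring

theorem tensorForm_even_even {x y : V} (hx : x ∈ Q.part 0) (hy : y ∈ Q.part 0) :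
    Q.tensorForm J x y = 0 := by
  induction J with
  | zero => simp
  | tmul α q => simp [tensorForm_tmul, Q.extendOdd_even q hx, Q.extendOdd_even q hy]
  | add a b ha hb => simp [ha, hb]

theorem tensorForm_odd_odd {x y : V} (hx : x ∈ Q.part 1) (hy : y ∈ Q.part 1) :
    Q.tensorForm J x y = 0 := by
  induction J with
  | zero => simp
  | tmul α q => simp [tensorForm_tmul, Q.extendEven_odd α hx, Q.extendEven_odd α hy]
  | add a b ha hb => simp [ha, hb]

/-- Only the values on `V₀ × V₁` carry information, and there the second term of the
antisymmetrization vanishes; injectivity of `dualDistrib` in finite dimension can then be used. -/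
theorem tensorForm_eq_dualDistrib (x : Q.part 0) (y : Q.part 1) :
    Q.tensorForm J x y = TensorProduct.dualDistrib ℂ (Q.part 0) (Q.part 1) J (x ⊗ₜ y) := by
  induction J with
  | zero => simp
  | tmul α q =>
    simp [tensorForm_tmul, Q.extendOdd_even q x.2, Q.extendEven_apply, Q.extendOdd_apply]
  | add a b ha hb => simp [ha, hb]

/-- A tensor in `V₀* ⊗ V₁*` is determined by the bilinear form it defines. -/
theorem tensor_ext [FiniteDimensional ℂ V]
    {J K : Module.Dual ℂ (Q.part 0) ⊗[ℂ] Module.Dual ℂ (Q.part 1)}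
    (h : ∀ x ∈ Q.part 0, ∀ y ∈ Q.part 1, Q.tensorForm J x y = Q.tensorForm K x y) : J = K := by
  apply (TensorProduct.dualDistribEquiv ℂ (Q.part 0) (Q.part 1)).injective
  change TensorProduct.dualDistrib ℂ (Q.part 0) (Q.part 1) J =
    TensorProduct.dualDistrib ℂ (Q.part 0) (Q.part 1) K
  ext x y
  simpa [tensorForm_eq_dualDistrib] using h x x.2 y y.2

variable {Q} {J}

theorem IsHomogeneous.even {C : V →ₗ[ℂ] V} (h : Q.IsHomogeneous 1 C) {x : V}
    (hx : x ∈ Q.part 0) : C x ∈ Q.part 1 := h 0 x hx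

theorem IsHomogeneous.odd {C : V →ₗ[ℂ] V} (h : Q.IsHomogeneous 1 C) {x : V}
    (hx : x ∈ Q.part 1) : C x ∈ Q.part 0 := h 1 x hx

theorem IsSkewSupersymmetric.even {C : V →ₗ[ℂ] V} (h : Q.IsSkewSupersymmetric 1 C) {x : V}
    (hx : x ∈ Q.part 0) (y : V) : Q.form (C x) y = -Q.form x (C y) := by
  simpa using h 0 x hx y

theorem IsSkewSupersymmetric.odd {C : V →ₗ[ℂ] V} (h : Q.IsSkewSupersymmetric 1 C) {x : V}
    (hx : x ∈ Q.part 1) (y : V) : Q.form (C x) y = Q.form x (C y) := by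
  simpa using h 1 x hx y

end QuadraticSuperspace

/-! ### From the associated invariant to an explicit bracket -/

namespace QuadraticLieSuperalgebra

variable {V : Type*} [AddCommGroup V] [Module ℂ V] (L : QuadraticLieSuperalgebra V)

/-- The bracket is the one with associated invariant `J ∧ p`, expressed through the odd
skew-supersymmetric map `C` with `J(X, Y) = B(C X, Y)`, not of the form `α ⊗ u` on `𝔤₀`, and the
odd vector `X₁` with `p = B(X₁, ·)`. -/
structure IsWedgeBracket (C : V →ₗ[ℂ] V) (X₁ : V) : Prop where
  odd : L.IsHomogeneous 1 C
  skew : L.IsSkewSupersymmetric 1 C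
  vec_odd : X₁ ∈ L.part 1
  vec_ne_zero : X₁ ≠ 0
  indecomposable : ∀ (α : Module.Dual ℂ V) (u : V), u ∈ L.part 1 →
    ¬ ∀ x ∈ L.part 0, C x = α x • u
  bracket_even_even : ∀ x ∈ L.part 0, ∀ y ∈ L.part 0, L.bracket x y = 0
  bracket_even_odd : ∀ x ∈ L.part 0, ∀ y ∈ L.part 1,
    L.bracket x y = -(L.form (C x) y • X₁) - L.form X₁ y • C x
  bracket_odd_odd : ∀ x ∈ L.part 1, ∀ y ∈ L.part 1,
    L.bracket x y = L.form X₁ y • C x + L.form X₁ x • C y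

variable {L}

/-- By non-degeneracy a bracket is determined by its pairings with homogeneous vectors, and these
are the values of `J ∧ p`. -/
theorem IsQuasiSingularWith.isWedgeBracket [FiniteDimensional ℂ V]
    {J : Module.Dual ℂ (L.part 0) ⊗[ℂ] Module.Dual ℂ (L.part 1)}
    {p : Module.Dual ℂ (L.part 1)} (h : L.IsQuasiSingularWith J p) :
    L.IsWedgeBracket (L.mapOf J) (L.vectorOf p) := by
  have hC : ∀ x y, L.form (L.mapOf J x) y = L.tensorForm J x y := fun x y =>
    L.form_phi_symm (L.tensorForm J x) y
  have hX : ∀ y, L.form (L.vectorOf p) y = L.extendOdd p y := fun y =>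
    L.form_phi_symm (L.extendOdd p) y
  have heven : ∀ x ∈ L.part 0, L.mapOf J x ∈ L.part 1 := fun x hx =>
    L.mem_part_one_of_form fun z hz => by rw [hC, L.tensorForm_even_even J hx hz]
  have hodd : ∀ x ∈ L.part 1, L.mapOf J x ∈ L.part 0 := fun x hx =>
    L.mem_part_zero_of_form fun z hz => by rw [hC, L.tensorForm_odd_odd J hx hz]
  have hinv := h.invariant_eq
  simp only [associatedInvariant, QuadraticSuperspace.superWedge, sum_zmod_two] at hinv
  constructor
  · intro i x hx
    rcases ExtensionDatum.parity_cases i with rfl | rfl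
    · exact heven x hx
    · exact hodd x hx
  · intro i x hx y
    rw [hC, L.tensorForm_antisymm, ← hC]
    rcases ExtensionDatum.parity_cases i with rfl | rfl
    · simp [L.form_comm_of_even hx]
    · simp [L.form_comm_of_odd hx]
  · exact L.mem_part_one_of_form fun z hz => by rw [hX, L.extendOdd_even p hz]
  · intro h0
    refine h.ne_zero (LinearMap.ext fun y => ?_)
    rw [← L.extendOdd_apply, ← hX, h0]
    simp
  · intro α u hu hαu
    -- If `C x = α(x) u` on even vectors, then `J` and `α ⊗ B(u, ·)` agree on even-odd pairs and
    -- hence as tensors.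
    refine h.indecomposable (α ∘ₗ (L.part 0).subtype) (L.form u ∘ₗ (L.part 1).subtype)
      (L.tensor_ext fun x hx y hy => ?_)
    have h1 := L.extendEven_apply (α ∘ₗ (L.part 0).subtype) ⟨x, hx⟩
    have h2 := L.extendOdd_apply (L.form u ∘ₗ (L.part 1).subtype) ⟨y, hy⟩
    simp only [LinearMap.comp_apply, Submodule.subtype_apply] at h1 h2
    rw [← hC, hαu x hx, L.tensorForm_tmul, h1, h2, L.extendOdd_even _ hx]
    simp
  · intro x hx y hy
    refine L.ext_form fun z => ?_
    rw [hinv]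
    simp [L.component_zero_even hx, L.component_one_even hx, L.component_zero_even hy,
      L.component_one_even hy, L.tensorForm_even_even J hx hy, L.extendOdd_even p hx,
      L.extendOdd_even p hy]
  · intro x hx y hy
    refine L.ext_form_homogeneous (fun z hz => ?_) (fun z hz => ?_) <;> rw [hinv]
    · simp [L.component_zero_even hx, L.component_one_even hx, L.component_zero_odd hy,
        L.component_one_odd hy, L.component_zero_even hz, L.component_one_even hz,
        L.tensorForm_even_even J hx hz, L.extendOdd_even p hx, L.extendOdd_even p hz, hC, hX]
    · simp [L.component_zero_even hx, L.component_one_even hx, L.component_zero_odd hy,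
        L.component_one_odd hy, L.component_zero_odd hz, L.component_one_odd hz,
        L.extendOdd_even p hx, hC, hX]
      ring
  · intro x hx y hy
    refine L.ext_form_homogeneous (fun z hz => ?_) (fun z hz => ?_) <;> rw [hinv]
    · simp [L.component_zero_odd hx, L.component_one_odd hx, L.component_zero_odd hy,
        L.component_one_odd hy, L.component_zero_even hz, L.component_one_even hz,
        show (1 : ZMod 2) + 1 = 0 from rfl, L.extendOdd_even p hz, hC, hX]
      ring
    · simp [L.component_zero_odd hx, L.component_one_odd hx, L.component_zero_odd hy,
        L.component_one_odd hy, L.component_zero_odd hz, L.component_one_odd hz,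
        L.tensorForm_odd_odd J hx hy, L.tensorForm_odd_odd J hx hz,
        L.tensorForm_odd_odd J hy hz, hC, hX]

end QuadraticLieSuperalgebra
end QuasiSingular

/-! ### Consequences of the Jacobi identity -/

namespace QuasiSingular
namespace QuadraticLieSuperalgebra

variable {V : Type*} [AddCommGroup V] [Module ℂ V] {L : QuadraticLieSuperalgebra V}

theorem bracket_odd_even {x y : V} (hx : x ∈ L.part 1) (hy : y ∈ L.part 0) :
    L.bracket x y = -L.bracket y x := by
  simpa using L.bracket_skew 1 0 x hx y hy

/-- The dual basis vector of a nonzero odd vector can be chosen odd. -/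
theorem exists_odd_form_eq_one {x : V} (hx : x ∈ L.part 1) (h0 : x ≠ 0) :
    ∃ y ∈ L.part 1, L.form x y = 1 := by
  by_contra! h
  refine h0 (L.ext_form_homogeneous (fun z hz => by simp [L.form_odd_even hx hz]) fun z hz => ?_)
  by_contra hne
  simp only [map_zero, LinearMap.zero_apply] at hne
  exact h ((L.form x z)⁻¹ • z) (Submodule.smul_mem _ _ hz) (by simp [hne])

theorem exists_even_form_eq_one {x : V} (hx : x ∈ L.part 0) (h0 : x ≠ 0) :
    ∃ y ∈ L.part 0, L.form x y = 1 := by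
  by_contra! h
  refine h0 (L.ext_form_homogeneous (fun z hz => ?_) fun z hz => by simp [L.form_even_odd hx hz])
  by_contra hne
  simp only [map_zero, LinearMap.zero_apply] at hne
  exact h ((L.form x z)⁻¹ • z) (Submodule.smul_mem _ _ hz) (by simp [hne])

/-- The center of a reduced quadratic Lie superalgebra lies in the derived ideal. -/
theorem IsReduced.center_le_derived
    [FiniteDimensional ℂ V] (hr : L.IsReduced) : L.center ≤ L.derived := by
  intro c hc
  by_contra hcd
  -- A functional that kills `[𝔤, 𝔤]` but not `c` is represented by a vector that is central by
  -- invariance, hence orthogonal to `c` by isotropy: a contradiction.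
  obtain ⟨f, hfc, hf⟩ := Submodule.exists_dual_map_eq_bot_of_notMem hcd inferInstance
  have hz : L.phi.symm f ∈ L.center := by
    refine LinearMap.mem_ker.2 (LinearMap.ext fun y => L.ext_form fun w => ?_)
    have : f (L.bracket y w) ∈ L.derived.map f :=
      Submodule.mem_map_of_mem (Submodule.subset_span ⟨y, w, rfl⟩)
    rw [hf, Submodule.mem_bot] at this
    rw [L.invariant, L.form_phi_symm, this]
    simp
  exact hfc (by rw [← L.form_phi_symm, hr.2 _ hz c hc])

namespace IsWedgeBracket

variable {C : V →ₗ[ℂ] V} {X₁ : V} (h : L.IsWedgeBracket C X₁)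
include h

theorem form_vec_vec : L.form X₁ X₁ = 0 := L.form_self_of_odd h.vec_odd

theorem form_vec_even {x : V} (hx : x ∈ L.part 0) : L.form X₁ x = 0 :=
  L.form_odd_even h.vec_odd hx

theorem form_vec_map (x : V) : L.form X₁ (C x) = L.form (C X₁) x := (h.skew.odd h.vec_odd x).symm

theorem form_map_vec {x : V} (hx : x ∈ L.part 0) : L.form (C x) X₁ = -L.form (C X₁) x := by
  rw [h.skew.even hx, L.form_comm_of_even hx]

theorem form_map_map_even {x y : V} (hx : x ∈ L.part 0) :
    L.form (C y) (C x) = -L.form (C x) (C y) :=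
  L.form_comm_of_odd (h.odd.even hx) _

/-- The Jacobi identity for one even and twice the same odd argument. -/
theorem map_map_even_eq {x y : V} (hx : x ∈ L.part 0) (hy : y ∈ L.part 1)
    (hxy : L.form X₁ y = 1) :
    C (C x) = -(L.form (C x) y • C X₁) - L.form (C X₁) x • C y := by
  have hj := L.jacobi 0 1 1 x hx y hy y hy
  have h1 : L.bracket x (L.bracket y y) = 0 :=
    h.bracket_even_even x hx _ (L.bracket_mem 1 1 y hy y hy)
  have h2 : L.bracket (L.bracket x y) y =
      -(L.form (C x) y • C X₁) - (C (C x) + L.form (C X₁) x • C y) := by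
    rw [h.bracket_even_odd x hx y hy]
    simp only [map_sub, map_neg, map_smul, LinearMap.sub_apply, LinearMap.neg_apply,
      LinearMap.smul_apply, h.bracket_odd_odd X₁ h.vec_odd y hy,
      h.bracket_odd_odd _ (h.odd.even hx) y hy, hxy, h.form_vec_vec, h.form_vec_map]
    module
  -- Both `y` and `[x, y]` are odd, so their bracket is symmetric and the identity becomes `2 [[x,
  -- y], y] = 0`.
  have h3 : L.bracket y (L.bracket x y) = L.bracket (L.bracket x y) y := by
    have := L.bracket_skew 1 1 y hy _ (L.bracket_mem 0 1 x hx y hy)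
    simpa using this
  rw [h1, h3, h2, superSign_zero_left, one_smul] at hj
  have h4 : (2 : ℂ) • (-(L.form (C x) y • C X₁) - (C (C x) + L.form (C X₁) x • C y)) = 0 := by
    rw [two_smul]; exact hj.symm
  have h5 := (smul_eq_zero.1 h4).resolve_left two_ne_zero
  rw [sub_eq_zero] at h5
  rw [h5]
  abel

/-- Even vectors commute, so the Jacobi identity makes the left side symmetric in `x` and `x'`. The
right side is not visibly symmetric, and comparing the two orders gives a constraint on `C`. -/
theorem bracket_bracket_even_even_odd {x x' y : V} (hx : x ∈ L.part 0) (hx' : x' ∈ L.part 0)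
    (hy : y ∈ L.part 1) (hxy : L.form X₁ y = 1) :
    L.bracket x (L.bracket x' y) =
      (-(L.form (C x') y * L.form (C X₁) x) + L.form (C x) (C x')) • X₁
        + L.form (C X₁) x' • C x := by
  rw [h.bracket_even_odd x' hx' y hy]
  simp only [map_sub, map_neg, map_smul, h.bracket_even_odd x hx X₁ h.vec_odd,
    h.bracket_even_odd x hx _ (h.odd.even hx'), hxy, h.form_vec_vec, h.form_vec_map,
    h.form_map_vec hx]
  module

/-- If `C X₁ ≠ 0` then `C` vanishes on the even vectors orthogonal to `C X₁`. -/
theorem map_eq_zero_of_form_eq_zero {x : V} (hx : x ∈ L.part 0) (hv : C X₁ ≠ 0)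
    (hvx : L.form (C X₁) x = 0) : C x = 0 := by
  obtain ⟨y, hy, hxy⟩ := exists_odd_form_eq_one h.vec_odd h.vec_ne_zero
  obtain ⟨x', hx', hvx'⟩ := exists_even_form_eq_one (h.odd.odd h.vec_odd) hv
  have hj := L.jacobi 0 0 1 x hx x' hx' y hy
  rw [h.bracket_even_even x hx x' hx', map_zero, LinearMap.zero_apply, zero_add,
    superSign_zero_left, one_smul, h.bracket_bracket_even_even_odd hx hx' hy hxy,
    h.bracket_bracket_even_even_odd hx' hx hy hxy, hvx, hvx', h.form_map_map_even hx] at hj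
  set r := L.form (C x) (C x') with hr
  -- The symmetry in `x` and `x'` leaves `C x` no component outside `ℂ X₁`.
  have hx1 : C x = -(L.form (C x) y + 2 * r) • X₁ := by
    rw [← sub_eq_zero] at hj ⊢
    rw [← hj]
    module
  -- Two values of `C (C x)`, from `hx1` and from the Jacobi identity, differ by `2 r C X₁`.
  have hx2 := h.map_map_even_eq hx hy hxy
  rw [hvx, hx1, map_smul, ← hx1] at hx2
  have hr0 : (2 * r) • C X₁ = 0 := by
    rw [← sub_eq_zero] at hx2
    rw [← neg_eq_zero, ← hx2]
    module
  have hr0 : r = 0 := by simpa [hv] using hr0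
  rw [hr0, mul_zero, add_zero] at hx1
  -- Pairing `C x = -B(C x, y) X₁` with `C x'`, where `B(X₁, C x') = B(C X₁, x') = 1`.
  have : r = -L.form (C x) y := by
    have := congrArg (fun w => L.form w (C x')) hx1
    simpa [h.form_vec_map, hvx'] using this
  have hxy0 : L.form (C x) y = 0 := by linear_combination this - hr0
  rw [hx1, hxy0]
  simp

/-- Otherwise `C` on the even part factors through the functional `B(C X₁, ·)`, and `J` would be
decomposable. -/
theorem map_vec : C X₁ = 0 := by
  by_contra hv
  obtain ⟨x', hx', hvx'⟩ := exists_even_form_eq_one (h.odd.odd h.vec_odd) hv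
  refine h.indecomposable (L.form (C X₁)) (C x') (h.odd.even hx') fun x hx => ?_
  have := h.map_eq_zero_of_form_eq_zero
    (sub_mem hx ((L.part 0).smul_mem (L.form (C X₁) x) hx')) hv (by simp [hvx'])
  rwa [map_sub, map_smul, sub_eq_zero] at this

theorem map_map_even {x : V} (hx : x ∈ L.part 0) : C (C x) = 0 := by
  obtain ⟨y, hy, hxy⟩ := exists_odd_form_eq_one h.vec_odd h.vec_ne_zero
  simp [h.map_map_even_eq hx hy hxy, h.map_vec]

theorem form_map_map_odd {y z : V} (hz : z ∈ L.part 1) :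
    L.form (C (C z)) y = -L.form (C y) (C z) := by
  rw [h.skew.even (h.odd.odd hz), L.form_comm_of_even (h.odd.odd hz)]

/-- The Jacobi identity for three odd arguments, two of them equal. -/
theorem map_map_odd_eq {y z : V} (hy : y ∈ L.part 1) (hz : z ∈ L.part 1)
    (hxy : L.form X₁ y = 1) :
    C (C z) + (2 * L.form X₁ z) • C (C y) =
      (2 * L.form (C y) (C z) + L.form X₁ z * L.form (C y) (C y)) • X₁ := by
  have hj := L.jacobi 1 1 1 y hy y hy z hz
  have h1 : ∀ w ∈ L.part 1,
      L.bracket y (C w) = -(L.form (C y) (C w)) • X₁ + C (C w) := fun w hw => by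
    rw [bracket_odd_even hy (h.odd.odd hw), h.bracket_even_odd _ (h.odd.odd hw) y hy, hxy,
      h.form_map_map_odd hw]
    module
  have h2 : L.form (C (C y)) z = -L.form (C y) (C z) := by
    -- `C y` is even, so the form is symmetric in `C y` and `C z`.
    rw [h.form_map_map_odd hy, L.form_comm_of_even (h.odd.odd hy)]
  simp only [h.bracket_odd_odd y hy z hz, h.bracket_odd_odd y hy y hy, hxy, map_add, map_smul,
    LinearMap.add_apply, LinearMap.smul_apply, h1 y hy, h1 z hz, superSign_one_one,
    h.bracket_even_odd _ (h.odd.odd hy) z hz, h2] at hj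
  rw [← sub_eq_zero] at hj ⊢
  -- The sign of two odd arguments turns the Jacobi identity into `2 [y, [y, z]] = [[y, y], z]`, and
  -- `[y, y] = 2 C y`.
  have h3 : (2 : ℂ) • (C (C z) + (2 * L.form X₁ z) • C (C y) -
      (2 * L.form (C y) (C z) + L.form X₁ z * L.form (C y) (C y)) • X₁) = 0 := by
    rw [← hj]
    module
  exact (smul_eq_zero.1 h3).resolve_left two_ne_zero

/-- `map_map_odd_eq` makes `C² z` a multiple of `X₁`, first for `z = y` and then in general. Pairing
with `y` reproduces the coefficient with the opposite sign and another factor, so it is zero. -/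
theorem map_map_odd {z : V} (hz : z ∈ L.part 1) : C (C z) = 0 := by
  obtain ⟨y, hy, hxy⟩ := exists_odd_form_eq_one h.vec_odd h.vec_ne_zero
  have h1 := h.map_map_odd_eq hy hy hxy
  -- For `z = y` the identity is `3 C² y = 3 B(C y, C y) X₁`; pairing with `y` gives `-3 B(C y, C y)
  -- = 3 B(C y, C y)`.
  have hr : L.form (C y) (C y) = 0 := by
    have := congrArg (fun w => L.form w y) h1
    simp only [map_add, map_smul, LinearMap.add_apply, LinearMap.smul_apply, smul_eq_mul, hxy,
      h.form_map_map_odd hy] at this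
    linear_combination -this / 6
  have hyy : C (C y) = 0 := by
    have h3 : (3 : ℂ) • C (C y) = 0 := by
      rw [hr, hxy] at h1
      simp only [mul_zero, mul_one, add_zero, zero_smul] at h1
      rw [← h1]
      module
    exact (smul_eq_zero.1 h3).resolve_left three_ne_zero
  have h2 := h.map_map_odd_eq hy hz hxy
  rw [hr, hyy, mul_zero, add_zero, smul_zero, add_zero] at h2
  -- Pairing `C² z = 2 B(C y, C z) X₁` with `y` gives `-B(C y, C z) = 2 B(C y, C z)`.
  have hs : L.form (C y) (C z) = 0 := by
    have := congrArg (fun w => L.form w y) h2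
    simp only [map_smul, LinearMap.smul_apply, smul_eq_mul, hxy, h.form_map_map_odd hz] at this
    linear_combination -this / 3
  simpa [hs] using h2

/-! ### The bracket in closed form, the center and the derived ideal -/

theorem map_map (x : V) : C (C x) = 0 := by
  obtain ⟨a, ha, b, hb, rfl⟩ := L.exists_add x
  simp [h.map_map_even ha, h.map_map_odd hb]

theorem form_map_map (x y : V) : L.form (C x) (C y) = 0 := by
  obtain ⟨a, ha, b, hb, rfl⟩ := L.exists_add x
  simp [h.skew.even ha, h.skew.odd hb, h.map_map]

theorem form_vec_map_eq_zero (x : V) : L.form X₁ (C x) = 0 := by simp [h.form_vec_map, h.map_vec]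

theorem form_map_vec_eq_zero (x : V) : L.form (C x) X₁ = 0 := by
  rw [L.form_comm_of_odd h.vec_odd, h.form_vec_map_eq_zero, neg_zero]

/-- The parity involution absorbs the sign by which the even-odd and odd-odd brackets differ, so one
formula serves arguments of mixed parity. -/
theorem bracket_eq (x y : V) :
    L.bracket x y =
      -(L.form (C x) y • X₁) + L.form X₁ x • C y - L.form X₁ y • C (L.parity x) := by
  obtain ⟨a, ha, b, hb, rfl⟩ := L.exists_add x
  obtain ⟨c, hc, d, hd, rfl⟩ := L.exists_add y
  have h1 : L.form (C b) c = -L.form (C c) b := by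
    rw [h.skew.odd hb, L.form_comm_of_odd (h.odd.even hc)]
  simp only [map_add, LinearMap.add_apply, h.bracket_even_even a ha c hc,
    h.bracket_even_odd a ha d hd, bracket_odd_even hb hc, h.bracket_even_odd c hc b hb,
    h.bracket_odd_odd b hb d hd, L.parity_even ha, L.parity_odd hb, map_neg,
    h.form_vec_even ha, h.form_vec_even hc, L.form_odd_even (h.odd.even ha) hc,
    L.form_even_odd (h.odd.odd hb) hd, h1]
  module

theorem map_parity_map (x : V) : C (L.parity (C x)) = 0 := by
  obtain ⟨a, ha, b, hb, rfl⟩ := L.exists_add x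
  simp [L.parity_odd (h.odd.even ha), L.parity_even (h.odd.odd hb), h.map_map]

theorem range_le_center : LinearMap.range C ≤ L.center := by
  rintro _ ⟨x, rfl⟩
  refine LinearMap.mem_ker.2 (LinearMap.ext fun y => ?_)
  simp [h.bracket_eq, h.map_map, h.form_vec_map_eq_zero, h.map_parity_map]

theorem vec_mem_center : X₁ ∈ L.center := by
  refine LinearMap.mem_ker.2 (LinearMap.ext fun y => ?_)
  simp [h.bracket_eq, h.map_vec, h.form_vec_vec, L.parity_odd h.vec_odd]

theorem range_sup_span_le_center : LinearMap.range C ⊔ Submodule.span ℂ {X₁} ≤ L.center :=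
  sup_le h.range_le_center ((Submodule.span_singleton_le_iff_mem _ _).2 h.vec_mem_center)

theorem derived_le : L.derived ≤ LinearMap.range C ⊔ Submodule.span ℂ {X₁} := by
  refine Submodule.span_le.2 ?_
  rintro _ ⟨x, y, rfl⟩
  have hC : ∀ z, C z ∈ LinearMap.range C ⊔ Submodule.span ℂ {X₁} := fun z =>
    Submodule.mem_sup_left (LinearMap.mem_range_self C z)
  have hX : X₁ ∈ LinearMap.range C ⊔ Submodule.span ℂ {X₁} :=
    Submodule.mem_sup_right (Submodule.mem_span_singleton_self X₁)
  rw [h.bracket_eq]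
  exact sub_mem (add_mem (neg_mem (Submodule.smul_mem _ _ hX)) (Submodule.smul_mem _ _ (hC y)))
    (Submodule.smul_mem _ _ (hC _))

theorem isTwoStepNilpotent : L.IsTwoStepNilpotent := by
  refine ⟨fun h0 => ?_, fun x y hy => ?_⟩
  · have hb : ∀ x y, L.bracket x y = 0 := fun x y => by
      have : L.bracket x y ∈ L.derived := Submodule.subset_span ⟨x, y, rfl⟩
      rwa [h0, Submodule.mem_bot] at this
    obtain ⟨y, hy, hxy⟩ := exists_odd_form_eq_one h.vec_odd h.vec_ne_zero
    have hCy : C y = 0 := by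
      have := h.bracket_odd_odd y hy y hy
      rw [hb, hxy, ← add_smul] at this
      exact (smul_eq_zero.1 this.symm).resolve_left (by norm_num)
    -- With all brackets zero, `[y, y] = 2 C y` gives `C y = 0`, and then `[x, y] = -C x` for even
    -- `x`. So `C` vanishes on the even part, contrary to indecomposability.
    refine h.indecomposable 0 0 (zero_mem _) fun x hx => ?_
    have := h.bracket_even_odd x hx y hy
    rw [hb, hxy, h.skew.even hx, hCy] at this
    simpa using this
  · obtain ⟨_, ⟨z, rfl⟩, w, hw, rfl⟩ := Submodule.mem_sup.1 (h.derived_le hy)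
    obtain ⟨c, rfl⟩ := Submodule.mem_span_singleton.1 hw
    simp [h.bracket_eq, h.form_map_map, h.map_map, h.map_vec, h.form_vec_map_eq_zero,
      h.form_vec_vec, h.form_map_vec_eq_zero]

end IsWedgeBracket
end QuadraticLieSuperalgebra
end QuasiSingular

/-! ### Splitting off an odd hyperbolic plane -/

namespace QuasiSingular

namespace QuadraticSuperspace

variable {V : Type*} [AddCommGroup V] [Module ℂ V] (Q : QuadraticSuperspace V) {X Y : V}

theorem mem_orthogonal_pair {x : V} :
    x ∈ Q.form.orthogonal (Submodule.span ℂ {X, Y}) ↔ Q.form X x = 0 ∧ Q.form Y x = 0 := by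
  rw [LinearMap.BilinForm.mem_orthogonal_iff]
  constructor
  · intro h
    exact ⟨h X (Submodule.subset_span (by simp)), h Y (Submodule.subset_span (by simp))⟩
  · rintro ⟨h1, h2⟩ n hn
    obtain ⟨a, b, rfl⟩ := Submodule.mem_span_pair.1 hn
    simp [h1, h2]

/-- The projection on the orthogonal of an odd hyperbolic pair. -/
noncomputable def hyperbolicProjection (hX : X ∈ Q.part 1) (hY : Y ∈ Q.part 1)
    (hXY : Q.form X Y = 1) : V →ₗ[ℂ] Q.form.orthogonal (Submodule.span ℂ {X, Y}) :=
  LinearMap.codRestrict _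
    (LinearMap.id + (Q.form Y).smulRight X - (Q.form X).smulRight Y) fun v => by
      rw [mem_orthogonal_pair]
      simp [hXY, Q.form_self_of_odd hX, Q.form_self_of_odd hY, Q.form_comm_of_odd hX Y]

theorem coe_hyperbolicProjection (hX : X ∈ Q.part 1) (hY : Y ∈ Q.part 1)
    (hXY : Q.form X Y = 1) (v : V) :
    (Q.hyperbolicProjection hX hY hXY v : V) = v + Q.form Y v • X - Q.form X v • Y := rfl

/-- The quadratic graded space `(ℂ X ⊕ ℂ Y)^⊥`, for an odd hyperbolic pair `X, Y`. -/
noncomputable def hyperbolicComplement (hX : X ∈ Q.part 1) (hY : Y ∈ Q.part 1)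
    (hXY : Q.form X Y = 1) :
    QuadraticSuperspace (Q.form.orthogonal (Submodule.span ℂ {X, Y})) where
  part i := (Q.part i).comap (Submodule.subtype _)
  isCompl := by
    constructor
    · rw [Submodule.disjoint_def]
      intro x h0 h1
      exact Subtype.ext (Submodule.disjoint_def.1 Q.isCompl.disjoint x h0 h1)
    · rw [codisjoint_iff, eq_top_iff]
      rintro ⟨x, hx⟩ -
      obtain ⟨a, ha, b, hb, rfl⟩ := Q.exists_add x
      rw [mem_orthogonal_pair] at hx
      -- `X` and `Y` are odd, so the even component is orthogonal to them automatically, and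
      -- therefore the odd one is too.
      have ha' : a ∈ Q.form.orthogonal (Submodule.span ℂ {X, Y}) :=
        Q.mem_orthogonal_pair.2 ⟨Q.form_odd_even hX ha, Q.form_odd_even hY ha⟩
      have hb' : b ∈ Q.form.orthogonal (Submodule.span ℂ {X, Y}) :=
        Q.mem_orthogonal_pair.2 ⟨by simpa [Q.form_odd_even hX ha] using hx.1,
          by simpa [Q.form_odd_even hY ha] using hx.2⟩
      exact Submodule.mem_sup.2 ⟨⟨a, ha'⟩, ha, ⟨b, hb'⟩, hb, rfl⟩
  form := Q.form.restrict _
  form_even i j hij x hx y hy := Q.form_even i j hij x hx y hy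
  form_supersymm i j x hx y hy := Q.form_supersymm i j x hx y hy
  nondegenerate := by
    -- A vector of the complement is orthogonal to `X` and `Y`, so it pairs with `v` as with the
    -- projection of `v`; non-degeneracy is inherited.
    have hv : ∀ v, v = (Q.hyperbolicProjection hX hY hXY v : V) - Q.form Y v • X
        + Q.form X v • Y := fun v => by
      rw [coe_hyperbolicProjection]; abel
    constructor
    · rintro ⟨x, hx⟩ h
      refine Subtype.ext (Q.ext_form fun v => ?_)
      have h1 : Q.form x (Q.hyperbolicProjection hX hY hXY v : V) = 0 :=
        h (Q.hyperbolicProjection hX hY hXY v)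
      rw [mem_orthogonal_pair] at hx
      rw [hv v]
      simp [h1, Q.form_comm_of_odd hX x, Q.form_comm_of_odd hY x, hx.1, hx.2]
    · rintro ⟨x, hx⟩ h
      refine Subtype.ext (Q.nondegenerate.2 x fun v => ?_)
      have h1 : Q.form (Q.hyperbolicProjection hX hY hXY v : V) x = 0 :=
        h (Q.hyperbolicProjection hX hY hXY v)
      rw [mem_orthogonal_pair] at hx
      rw [hv v]
      simp [h1, hx.1, hx.2]

/-- The decomposition `V = (ℂ X ⊕ ℂ Y)^⊥ ⊕ ℂ X ⊕ ℂ Y` for an odd hyperbolic pair `X, Y`. -/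
noncomputable def hyperbolicEquiv (hX : X ∈ Q.part 1) (hY : Y ∈ Q.part 1)
    (hXY : Q.form X Y = 1) :
    V ≃ₗ[ℂ] Q.form.orthogonal (Submodule.span ℂ {X, Y}) × ℂ × ℂ :=
  -- The coordinate along `X` is `-B(Y, v)` because `B(Y, X) = -1`.
  { (Q.hyperbolicProjection hX hY hXY).prod ((-Q.form Y).prod (Q.form X)) with
    invFun := fun u => (u.1 : V) + u.2.1 • X + u.2.2 • Y
    left_inv := fun v => by
      simp [coe_hyperbolicProjection]
      abel
    right_inv := by
      rintro ⟨⟨x, hx⟩, a, b⟩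
      rw [mem_orthogonal_pair] at hx
      have h1 : Q.form X (x + a • X + b • Y) = b := by
        simp [hx.1, Q.form_self_of_odd hX, hXY]
      have h2 : Q.form Y (x + a • X + b • Y) = -a := by
        simp [hx.2, Q.form_self_of_odd hY, Q.form_comm_of_odd hX Y, hXY]
      refine Prod.ext (Subtype.ext ?_) (Prod.ext ?_ ?_)
      · change (Q.hyperbolicProjection hX hY hXY (x + a • X + b • Y) : V) = x
        rw [coe_hyperbolicProjection, h1, h2]
        module
      · change -Q.form Y (x + a • X + b • Y) = a
        rw [h2, neg_neg]
      · exact h1 }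

theorem hyperbolicEquiv_add (hX : X ∈ Q.part 1) (hY : Y ∈ Q.part 1) (hXY : Q.form X Y = 1)
    (x : Q.form.orthogonal (Submodule.span ℂ {X, Y})) (a b : ℂ) :
    Q.hyperbolicEquiv hX hY hXY (x + a • X + b • Y) = (x, a, b) :=
  (Q.hyperbolicEquiv hX hY hXY).apply_symm_apply (x, a, b)

theorem exists_hyperbolic_add (hX : X ∈ Q.part 1) (hY : Y ∈ Q.part 1) (hXY : Q.form X Y = 1)
    (v : V) : ∃ (x : Q.form.orthogonal (Submodule.span ℂ {X, Y})) (a b : ℂ),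
      v = x + a • X + b • Y :=
  ⟨_, _, _, ((Q.hyperbolicEquiv hX hY hXY).symm_apply_apply v).symm⟩

end QuadraticSuperspace

/-! ### The extension datum and the isometry with its extension -/

namespace QuadraticLieSuperalgebra
namespace IsWedgeBracket

variable {V : Type*} [AddCommGroup V] [Module ℂ V] {L : QuadraticLieSuperalgebra V}
  {C : V →ₗ[ℂ] V} {X₁ Y₁ : V} (h : L.IsWedgeBracket C X₁)
include h

theorem form_vec_right_eq_zero {x : V} (hx : L.form X₁ x = 0) : L.form x X₁ = 0 := by
  rw [L.form_comm_of_odd h.vec_odd, hx, neg_zero]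

theorem form_map_eq_form_right (hY : Y₁ ∈ L.part 1) (x : V) :
    L.form (C Y₁) x = L.form x (C Y₁) :=
  (L.form_comm_of_even (h.odd.odd hY) x).symm

/-- `C x` is already orthogonal to `X₁`, and `B(Y₁, C x) = B(C Y₁, x)`. Since `B(Y₁, X₁) = -1`, the
added multiple of `X₁` cancels this pairing. -/
theorem add_smul_mem_orthogonal (hY : Y₁ ∈ L.part 1) (hXY : L.form X₁ Y₁ = 1) (x : V) :
    C x + L.form x (C Y₁) • X₁ ∈ L.form.orthogonal (Submodule.span ℂ {X₁, Y₁}) := by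
  rw [L.mem_orthogonal_pair]
  have h1 := h.skew.odd hY x
  rw [h.form_map_eq_form_right hY] at h1
  simp [h.form_vec_map_eq_zero, h.form_vec_vec, ← h1, L.form_comm_of_odd h.vec_odd Y₁, hXY]

/-- The extension datum on `𝔮 = (ℂ X₁ ⊕ ℂ Y₁)^⊥` given by the `𝔮`-part of `C` and the vector
`2 C Y₁`. -/
noncomputable def datum (hY : Y₁ ∈ L.part 1) (hXY : L.form X₁ Y₁ = 1) :
    ExtensionDatum (L.form.orthogonal (Submodule.span ℂ {X₁, Y₁})) where
  toQuadraticSuperspace := L.hyperbolicComplement h.vec_odd hY hXY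
  map := LinearMap.codRestrict _
    ((C + (L.form.flip (C Y₁)).smulRight X₁) ∘ₗ Submodule.subtype _)
    fun x => h.add_smul_mem_orthogonal hY hXY x
  map_odd := by
    rintro i ⟨x, hx'⟩ (hx : x ∈ L.part i)
    change C x + L.form x (C Y₁) • X₁ ∈ L.part (i + 1)
    rcases ExtensionDatum.parity_cases i with rfl | rfl
    · exact add_mem (h.odd.even hx) (Submodule.smul_mem _ _ h.vec_odd)
    · rw [L.form_odd_even hx (h.odd.odd hY), zero_smul, add_zero]
      exact h.odd.odd hx
  map_skew := by
    rintro i ⟨x, hx'⟩ (hx : x ∈ L.part i) ⟨y, hy'⟩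
    change L.form (C x + L.form x (C Y₁) • X₁) y =
      -superSign 1 i * L.form x (C y + L.form y (C Y₁) • X₁)
    -- The corrections along `X₁` pair to zero with vectors of `𝔮`, so skew-supersymmetry passes
    -- from `C` to its `𝔮`-part.
    rw [L.mem_orthogonal_pair] at hx' hy'
    have := h.skew i x hx y
    simpa [hy'.1, h.form_vec_right_eq_zero hx'.1] using this
  map_sq := by
    rintro ⟨x, hx'⟩
    apply Subtype.ext
    change C (C x + L.form x (C Y₁) • X₁) +
      L.form (C x + L.form x (C Y₁) • X₁) (C Y₁) • X₁ = 0
    simp [h.map_map, h.map_vec, h.form_map_map, h.form_vec_map_eq_zero]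
  vec := ⟨(2 : ℂ) • C Y₁, Submodule.smul_mem _ _ (L.mem_orthogonal_pair.2
    ⟨h.form_vec_map_eq_zero Y₁, L.form_odd_even hY (h.odd.odd hY)⟩)⟩
  vec_even := Submodule.smul_mem _ _ (h.odd.odd hY)
  vec_isotropic := by
    change L.form ((2 : ℂ) • C Y₁) ((2 : ℂ) • C Y₁) = 0
    simp [h.form_map_map]
  map_vec := by
    apply Subtype.ext
    change C ((2 : ℂ) • C Y₁) + L.form ((2 : ℂ) • C Y₁) (C Y₁) • X₁ = 0
    simp [h.map_map, h.form_map_map]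

section

variable (hY : Y₁ ∈ L.part 1) (hXY : L.form X₁ Y₁ = 1)

theorem coe_datum_map (x : L.form.orthogonal (Submodule.span ℂ {X₁, Y₁})) :
    ((h.datum hY hXY).map x : V) = C x + L.form x (C Y₁) • X₁ := rfl

theorem coe_datum_vec : ((h.datum hY hXY).vec : V) = (2 : ℂ) • C Y₁ := rfl

theorem coe_datum_theta (x : L.form.orthogonal (Submodule.span ℂ {X₁, Y₁})) :
    ((h.datum hY hXY).theta x : V) = L.parity x := by
  obtain ⟨a, ha, b, hb, rfl⟩ := (h.datum hY hXY).exists_add x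
  rw [map_add, (h.datum hY hXY).theta_even ha, (h.datum hY hXY).theta_odd hb]
  simp only [Submodule.coe_add, Submodule.coe_neg, map_add]
  rw [L.parity_even (x := a) ha, L.parity_odd (x := b) hb]

include hY hXY in
theorem bracket_self : L.bracket Y₁ Y₁ = (2 : ℂ) • C Y₁ := by
  rw [h.bracket_odd_odd Y₁ hY Y₁ hY, hXY]
  module

include hY hXY in
theorem bracket_left_of_form_vec {x : V} (hx : L.form X₁ x = 0) :
    L.bracket Y₁ x = C x - L.form x (C Y₁) • X₁ := by
  rw [h.bracket_eq, hx, hXY, h.form_map_eq_form_right hY]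
  module

theorem bracket_of_form_vec {x y : V} (hx : L.form X₁ x = 0) (hy : L.form X₁ y = 0) :
    L.bracket x y = -(L.form (C x) y • X₁) := by
  rw [h.bracket_eq, hx, hy]
  module

/-- The bracket formulas only need orthogonality to `X₁`, which `𝔮 + ℂ X₁` satisfies since `X₁` is
isotropic. -/
theorem form_vec_of_mem_sup {x : V}
    (hx : x ∈ L.form.orthogonal (Submodule.span ℂ {X₁, Y₁}) ⊔ Submodule.span ℂ {X₁}) :
    L.form X₁ x = 0 := by
  obtain ⟨y, hy, z, hz, rfl⟩ := Submodule.mem_sup.1 hx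
  obtain ⟨c, rfl⟩ := Submodule.mem_span_singleton.1 hz
  simp [(L.mem_orthogonal_pair.1 hy).1, h.form_vec_vec]

theorem isIsometricIso :
    L.IsIsometricIso (h.datum hY hXY).extension (L.hyperbolicEquiv h.vec_odd hY hXY) where
  map_part := by
    intro i v hv
    have h1 : L.hyperbolicEquiv h.vec_odd hY hXY v =
        (L.hyperbolicProjection h.vec_odd hY hXY v, -L.form Y₁ v, L.form X₁ v) := rfl
    rw [h1]
    change _ ∈ (h.datum hY hXY).extPart i
    rcases ExtensionDatum.parity_cases i with rfl | rfl
    · rw [ExtensionDatum.mem_extPart_zero]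
      refine ⟨?_, by simp [L.form_odd_even hY hv, h.form_vec_even hv]⟩
      change (L.hyperbolicProjection h.vec_odd hY hXY v : V) ∈ L.part 0
      rw [L.coe_hyperbolicProjection, L.form_odd_even hY hv, h.form_vec_even hv]
      simpa using hv
    · rw [ExtensionDatum.mem_extPart_one]
      change (L.hyperbolicProjection h.vec_odd hY hXY v : V) ∈ L.part 1
      rw [L.coe_hyperbolicProjection]
      exact sub_mem (add_mem hv (Submodule.smul_mem _ _ h.vec_odd)) (Submodule.smul_mem _ _ hY)
  map_bracket := by
    intro v w
    obtain ⟨x, a, b, rfl⟩ := L.exists_hyperbolic_add h.vec_odd hY hXY v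
    obtain ⟨y, c, d, rfl⟩ := L.exists_hyperbolic_add h.vec_odd hY hXY w
    rw [L.hyperbolicEquiv_add, L.hyperbolicEquiv_add, ← LinearEquiv.eq_symm_apply]
    have hx := L.mem_orthogonal_pair.1 x.2
    have hy := L.mem_orthogonal_pair.1 y.2
    -- The inverse equivalence moves the identity into `V`, where the bracket of the extension is
    -- written out in its three coordinates.
    change L.bracket _ _ =
      (((b • (h.datum hY hXY).map y - d • (h.datum hY hXY).map ((h.datum hY hXY).theta x)
        + (b * d) • (h.datum hY hXY).vec :
          L.form.orthogonal (Submodule.span ℂ {X₁, Y₁})) : V)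
        + (-L.form ((h.datum hY hXY).map x : V) y - b * L.form y ((2 : ℂ) • C Y₁)
          + d * L.form x ((2 : ℂ) • C Y₁)) • X₁ + (0 : ℂ) • Y₁)
    -- `C Y₁` is even, so only the even component of `x` contributes.
    have hp : L.form (L.parity x) (C Y₁) = L.form x (C Y₁) := by
      obtain ⟨s, hs, t, ht, hst⟩ := L.exists_add (x : V)
      simp [hst, L.parity_even hs, L.parity_odd ht, L.form_odd_even ht (h.odd.odd hY)]
    have hf : L.form (C x) Y₁ = -L.form x (C Y₁) := by
      rw [L.form_comm_of_odd hY, ← h.skew.odd hY, h.form_map_eq_form_right hY]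
    simp only [Submodule.coe_add, Submodule.coe_sub, Submodule.coe_smul, h.coe_datum_map,
      h.coe_datum_theta, h.coe_datum_vec, hp]
    rw [h.bracket_eq]
    simp only [map_add, map_smul, LinearMap.add_apply, LinearMap.smul_apply, smul_eq_mul, hx.1,
      hy.1, h.form_vec_vec, hXY, h.map_vec, L.parity_odd h.vec_odd, L.parity_odd hY, map_neg, hf,
      h.form_map_vec_eq_zero, h.form_map_eq_form_right hY,
      L.form_odd_even hY (h.odd.odd hY), map_zero, LinearMap.zero_apply]
    module
  map_form := by
    intro v w
    obtain ⟨x, a, b, rfl⟩ := L.exists_hyperbolic_add h.vec_odd hY hXY v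
    obtain ⟨y, c, d, rfl⟩ := L.exists_hyperbolic_add h.vec_odd hY hXY w
    rw [L.hyperbolicEquiv_add, L.hyperbolicEquiv_add]
    have hx := L.mem_orthogonal_pair.1 x.2
    have hy := L.mem_orthogonal_pair.1 y.2
    change L.form x y + (a * d - b * c) = _
    simp only [map_add, map_smul, LinearMap.add_apply, LinearMap.smul_apply, smul_eq_mul,
      L.form_comm_of_odd h.vec_odd (x : V), L.form_comm_of_odd hY (x : V), hx.1, hx.2, hy.1, hy.2,
      h.form_vec_vec, L.form_self_of_odd hY, L.form_comm_of_odd h.vec_odd Y₁, hXY]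
    ring

end

end IsWedgeBracket
end QuadraticLieSuperalgebra
end QuasiSingular

/-! ### The structure theorem -/

open QuasiSingular in
theorem corollary3p6p5 {V : Type*} [AddCommGroup V] [Module ℂ V] [FiniteDimensional ℂ V]
    (L : QuadraticLieSuperalgebra V)
    (J : TensorProduct ℂ (Module.Dual ℂ (L.part 0)) (Module.Dual ℂ (L.part 1)))
    (p : Module.Dual ℂ (L.part 1)) (h : L.IsQuasiSingularWith J p)
    (C : V →ₗ[ℂ] V) (hC : C = L.mapOf J) (X₁ : V) (hX₁ : X₁ = L.vectorOf p) :
    -- `C` is odd, skew-supersymmetric, of square zero, with central image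
    L.IsHomogeneous 1 C ∧ L.IsSkewSupersymmetric 1 C ∧ (∀ X, C (C X) = 0) ∧
    LinearMap.range C ≤ L.center ∧
    -- the derived ideal and the center
    L.derived ≤ LinearMap.range C ⊔ Submodule.span ℂ {X₁} ∧
    LinearMap.range C ⊔ Submodule.span ℂ {X₁} ≤ L.center ∧
    L.IsTwoStepNilpotent ∧
    (L.IsReduced →
      L.derived = LinearMap.range C ⊔ Submodule.span ℂ {X₁} ∧
      LinearMap.range C ⊔ Submodule.span ℂ {X₁} = L.center) ∧
    -- the structure with respect to an odd vector `Y₁` with `B(X₁, Y₁) = 1`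
    X₁ ∈ L.part 1 ∧ (∃ Y₁ ∈ L.part 1, L.form X₁ Y₁ = 1) ∧
    (∀ Y₁ ∈ L.part 1, L.form X₁ Y₁ = 1 → ∀ (X₀ : V) (q : Submodule ℂ V), X₀ = C Y₁ →
      q = L.form.orthogonal (Submodule.span ℂ {X₁, Y₁}) →
      -- the bracket in terms of `C`
      L.bracket Y₁ Y₁ = (2 : ℂ) • X₀ ∧
      (∀ X ∈ q ⊔ Submodule.span ℂ {X₁}, L.bracket Y₁ X = C X - L.form X X₀ • X₁) ∧
      (∀ X ∈ q ⊔ Submodule.span ℂ {X₁}, ∀ Y ∈ q ⊔ Submodule.span ℂ {X₁},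
        L.bracket X Y = -(L.form (C X) Y • X₁)) ∧
      -- `𝔮` with the induced grading and form, the `𝔮`-part of `C` and the vector `2 X₀`
      -- form a datum whose generalized double extension is `𝔤`
      ∃ D : ExtensionDatum q,
        (∀ i, D.part i = (L.part i).comap q.subtype) ∧
        (∀ X Y : q, D.form X Y = L.form X Y) ∧
        (∀ X : q, C X = (D.map X : V) - L.form X X₀ • X₁) ∧
        (D.vec : V) = (2 : ℂ) • X₀ ∧
        L.bracket Y₁ Y₁ = D.vec ∧
        (∀ X : q, L.bracket Y₁ X = (D.map X : V) - L.form X D.vec • X₁) ∧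
        (∀ X Y : q, L.bracket X Y = -(L.form (D.map X : V) Y • X₁)) ∧
        ∃ e : V ≃ₗ[ℂ] q × ℂ × ℂ,
          (∀ (X : q) (a b : ℂ), e (X + a • X₁ + b • Y₁) = (X, a, b)) ∧
          L.IsIsometricIso D.extension e) ∧
    L.IsGeneralizedDoubleExtension := by
  subst hC hX₁
  have hw := h.isWedgeBracket
  obtain ⟨Y, hY, hXY⟩ :=
    QuadraticLieSuperalgebra.exists_odd_form_eq_one hw.vec_odd hw.vec_ne_zero
  refine ⟨hw.odd, hw.skew, hw.map_map, hw.range_le_center, hw.derived_le,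
    hw.range_sup_span_le_center, hw.isTwoStepNilpotent, fun hr => ⟨?_, ?_⟩, hw.vec_odd,
    ⟨Y, hY, hXY⟩, ?_, ?_⟩
  · exact le_antisymm hw.derived_le (hw.range_sup_span_le_center.trans hr.center_le_derived)
  · exact le_antisymm hw.range_sup_span_le_center (hr.center_le_derived.trans hw.derived_le)
  · rintro Y₁ hY₁ hXY₁ _ _ rfl rfl
    have hq : ∀ x : L.form.orthogonal (Submodule.span ℂ {L.vectorOf p, Y₁}),
        L.form (L.vectorOf p) x = 0 := fun x => (L.mem_orthogonal_pair.1 x.2).1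
    refine ⟨hw.bracket_self hY₁ hXY₁,
      fun X hX => hw.bracket_left_of_form_vec hY₁ hXY₁ (hw.form_vec_of_mem_sup hX),
      fun X hX Y hY => hw.bracket_of_form_vec (hw.form_vec_of_mem_sup hX)
        (hw.form_vec_of_mem_sup hY),
      hw.datum hY₁ hXY₁, fun _ => rfl, fun _ _ => rfl, fun X => ?_, rfl,
      hw.bracket_self hY₁ hXY₁, fun X => ?_, fun X Y => ?_,
      L.hyperbolicEquiv hw.vec_odd hY₁ hXY₁, L.hyperbolicEquiv_add hw.vec_odd hY₁ hXY₁,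
      hw.isIsometricIso hY₁ hXY₁⟩
    · rw [hw.coe_datum_map]
      abel
    -- Replacing `C` by its `𝔮`-part costs a second `-B(X, X₀) X₁`, which is why the vector of the
    -- datum is `2 X₀`.
    · rw [hw.bracket_left_of_form_vec hY₁ hXY₁ (hq X), hw.coe_datum_map, hw.coe_datum_vec,
        map_smul]
      module
    · rw [hw.bracket_of_form_vec (hq X) (hq Y), hw.coe_datum_map]
      simp [hq Y]
  · exact ⟨_, _, _, inferInstance, hw.datum hY hXY, L.hyperbolicEquiv hw.vec_odd hY hXY,
      hw.isIsometricIso hY hXY⟩
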